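/- Let $(C_\bullet,\partial^C)$ be a chain complex of abelian groups, indexed by $n\in\mathbb{Z}$, in which each $C_n$ is free abelian with basis a finite set $K_n$ and $K_n=\emptyset$ for all but finitely many $n$. Let $(G_\bullet,\partial^G)$ be a chain complex of finite abelian groups, indexed by $n\in\mathbb{Z}$. For $p\in\mathbb{Z}$ let $\hom(C,G)^p=\prod_n \mathrm{Hom}(C_n,G_{n-p})$, with differential $(\delta^p f)_n=f_{n-1}\partial^C_n-(-1)^p\partial^G_{n-p}f_n$, and let $H^p(C,G)=\ker\delta^p/\operatorname{im}\delta^{p-1}$; in particular $H^0(C,G)$ is the group of homotopy classes of chain maps $C\to G$. For an abelian group $S$ let $H^n(C,S)$ be the degree-$n$ cohomology of the cochain complex $\mathrm{Hom}(C_\bullet,S)$, with $d^n f=f\partial^C_{n+1}$. Let $\mathcal{H}=\bigotimes_n\bigotimes_{x\in K_n}\mathbb{C}[G_n]$, with orthonormal basis $|f\rangle=\bigotimes_n\bigotimes_{x\in K_n}|f_n(x)\rangle$, $f\in\hom(C,G)^0$. For $t\in\hom(C,G)^{-1}$ and a character $m$ of $\hom(C,G)^1$ (a homomorphism to $U(1)$)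 put $A_t|f\rangle=|f+\delta^{-1}t\rangle$ and $B_m|f\rangle=m(\delta^0 f)\,|f\rangle$. For $x\in K_n$ put $$A_x^0=\frac{1}{|G_{n+1}|}\sum_{g\in G_{n+1}}A_{gx^*},\qquad B_x^0=\frac{1}{|G_{n-1}|}\sum_{r\in\widehat{G_{n-1}}}B_{rx_*},$$ where $gx^*\in\hom(C,G)^{-1}$ sends $x$ to $g$ and every other basis element to $0$, the set $\widehat{G_{n-1}}$ is the group of characters $r:G_{n-1}\to U(1)$, and $rx_*$ is the character $v\mapsto r(v_n(x))$ of $\hom(C,G)^1$. Let $$H=-\sum_n\sum_{x\in K_n}A_x^0-\sum_n\sum_{y\in K_n}B_y^0 .$$ Then $H$ is self-adjoint, its lowest eigenvalue is $-2\sum_n|K_n|$, and the corresponding eigenspace (the ground state subspace) is $$\mathcal{H}_0=\{\psi\in\mathcal{H} : A_x^0\psi=B_x^0\psi=\psi\ \text{ for all } n \text{ and all } x\in K_n\}.$$ The group $H^0(C,G)$ is finite, it is isomorphic to $\prod_n H^n(C,H_n(G))$, the groups $H^n(C,H_n(G))$ are trivial for all but finitely many $n$, and $$\dim\mathcal{H}_0=|H^0(C,G)|=\prod_n|H^n(C,H_n(G))|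 .$$ -/

import Mathlib

open CategoryTheory

/-! ### The internal Hom complex of two chain complexes of abelian groups -/

/-- A `p`-map `C → G` is a family of morphisms `C_n → G_{n-p}`. The index runs over the pairs
`(n, m)` with `m + p = n`, so that no transport along `m = n - p` is needed. -/
abbrev PMap (C : ChainComplex AddCommGrpCat ℤ) (G : ChainComplex AddCommGrpCat ℤ) (p : ℤ) :
    Type _ :=
  ∀ i : {q : ℤ × ℤ // q.2 + p = q.1}, C.X i.1.1 →+ G.X i.1.2

/-- The component `f_n : C_n → G_m` of a `p`-map, where `m = n - p`. -/
def PMap.comp {C : ChainComplex AddCommGrpCat ℤ} {G : ChainComplex AddCommGrpCat ℤ} {p : ℤ}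
    (f : PMap C G p) (n m : ℤ) (h : m + p = n) : C.X n →+ G.X m :=
  f ⟨(n, m), h⟩

/-- The differential `(δ^p f)_n = f_{n-1} ∂_n - (-1)^p ∂_{n-p} f_n` of the internal Hom complex,
from `p`-maps to `q`-maps with `q = p + 1`. -/
def PMap.delta (C : ChainComplex AddCommGrpCat ℤ) (G : ChainComplex AddCommGrpCat ℤ)
    (p q : ℤ) (hpq : p + 1 = q) : PMap C G p →+ PMap C G q where
  toFun f := fun i =>
    (f.comp (i.1.1 - 1) i.1.2 (by have := i.2; omega)).comp (C.d i.1.1 (i.1.1 - 1)).hom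
      - (p.negOnePow : ℤ) •
        (G.d (i.1.2 + 1) i.1.2).hom.comp (f.comp i.1.1 (i.1.2 + 1) (by have := i.2; omega))
  map_zero' := by
    funext i
    ext x
    simp [PMap.comp]
  map_add' f g := by
    funext i
    ext x
    simp [PMap.comp]
    abel

theorem PMap.delta_delta (C : ChainComplex AddCommGrpCat ℤ) (G : ChainComplex AddCommGrpCat ℤ)
    (p q r : ℤ) (hpq : p + 1 = q) (hqr : q + 1 = r) (f : PMap C G p) :
    PMap.delta C G q r hqr (PMap.delta C G p q hpq f) = 0 := by
  subst hpq
  funext i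
  ext x
  have h1 : (C.d (i.1.1 - 1) (i.1.1 - 1 - 1)).hom ((C.d i.1.1 (i.1.1 - 1)).hom x) = 0 := by
    rw [← AddCommGrpCat.comp_apply, C.d_comp_d]
    rfl
  have h2 : ∀ y, (G.d (i.1.2 + 1) i.1.2).hom ((G.d (i.1.2 + 1 + 1) (i.1.2 + 1)).hom y) = 0 := by
    intro y
    rw [← AddCommGrpCat.comp_apply, G.d_comp_d]
    rfl
  simp [PMap.delta, PMap.comp, h1, h2, Int.negOnePow_succ]

/-- The cohomology `H^p(C, G) = ker δ^p / im δ^{p-1}` of the internal Hom complex. -/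
abbrev HomCohomology (C : ChainComplex AddCommGrpCat ℤ) (G : ChainComplex AddCommGrpCat ℤ)
    (p : ℤ) : Type _ :=
  (PMap.delta C G p (p + 1) rfl).ker ⧸
    (PMap.delta C G (p - 1) p (by omega)).range.addSubgroupOf
      (PMap.delta C G p (p + 1) rfl).ker

/-- Precomposition with the boundary map: `Hom(C_i, S) → Hom(C_j, S)`, `f ↦ f ∘ ∂`, where
`∂ : C_j → C_i` (the boundary map of `C` if `j = i + 1`). -/
def coeffD (C : ChainComplex AddCommGrpCat ℤ) (S : Type*) [AddCommGroup S] (i j : ℤ) :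
    (C.X i →+ S) →+ (C.X j →+ S) where
  toFun f := f.comp (C.d j i).hom
  map_zero' := by
    ext x
    simp
  map_add' f g := by
    ext x
    simp

/-- The cohomology `H^n(C, S)` of `C` with coefficients in the abelian group `S`, that is, the
cohomology of the cochain complex `Hom(C_n, S)` in degree `n`. -/
abbrev CoeffCohomology (C : ChainComplex AddCommGrpCat ℤ) (S : Type*) [AddCommGroup S]
    (n : ℤ) : Type _ :=
  (coeffD C S n (n + 1)).ker ⧸
    (coeffD C S (n - 1) n).range.addSubgroupOf (coeffD C S n (n + 1)).ker

/-! ### The Hilbert space -/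

section StateSpace

variable (K : ℤ → Type*) (G : ChainComplex AddCommGrpCat ℤ)

/-- The state space `⨂_n ⨂_{x ∈ K_n} ℂ[G_n]`. -/
def StateSpace : Type _ :=
  PiTensorProduct ℂ (fun x : (Σ n, K n) => AddMonoidAlgebra ℂ (G.X x.1))

noncomputable instance : AddCommGroup (StateSpace K G) :=
  inferInstanceAs (AddCommGroup (PiTensorProduct ℂ _))

noncomputable instance : Module ℂ (StateSpace K G) :=
  inferInstanceAs (Module ℂ (PiTensorProduct ℂ _))

variable [Fintype (Σ n, K n)]

/-- The basis of the state space formed by the tensors `⨂_x |v_x⟩` with `v_x ∈ G_n` for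
`x ∈ K_n`. -/
noncomputable def productBasis :
    Module.Basis (∀ x : (Σ n, K n), G.X x.1) ℂ (StateSpace K G) :=
  Basis.piTensorProduct (fun x : (Σ n, K n) => AddMonoidAlgebra.basis (G.X x.1) ℂ)

theorem productBasis_apply (v : ∀ x : (Σ n, K n), G.X x.1) :
    productBasis K G v =
      PiTensorProduct.tprod ℂ
        (fun x : (Σ n, K n) =>
          (AddMonoidAlgebra.single (v x) 1 : AddMonoidAlgebra ℂ (G.X x.1))) :=
  (Basis.piTensorProduct_apply _ _).trans (by simp only [AddMonoidAlgebra.basis_apply])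

variable [∀ n, Fintype (G.X n)]

/-- The inner product for which the tensors `⨂_x |v_x⟩` form an orthonormal basis. -/
@[reducible]
noncomputable def stateSpaceCore : InnerProductSpace.Core ℂ (StateSpace K G) := by
  classical
  exact
  { inner := fun φ ψ => ∑ v, (starRingEnd ℂ) ((productBasis K G).repr φ v) *
      (productBasis K G).repr ψ v
    conj_inner_symm := fun φ ψ => by simp [mul_comm]
    re_inner_nonneg := fun φ => by
      rw [map_sum]
      refine Finset.sum_nonneg fun v _ => ?_
      rw [mul_comm, Complex.mul_conj]
      simpa using Complex.normSq_nonneg _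
    add_left := fun φ ψ χ => by simp [add_mul, Finset.sum_add_distrib]
    smul_left := fun φ ψ c => by simp [Finset.mul_sum, mul_assoc]
    definite := fun φ h => by
      have h' : ∑ v, Complex.normSq ((productBasis K G).repr φ v) = 0 := by
        have := congrArg Complex.re h
        simpa [mul_comm, Complex.mul_conj] using this
      rw [Finset.sum_eq_zero_iff_of_nonneg (fun v _ => Complex.normSq_nonneg _)] at h'
      apply (productBasis K G).ext_elem
      intro v
      simpa using h' v (Finset.mem_univ v) }

noncomputable instance : NormedAddCommGroup (StateSpace K G) :=
  (stateSpaceCore K G).toNormedAddCommGroup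

noncomputable instance : InnerProductSpace ℂ (StateSpace K G) :=
  InnerProductSpace.ofCore (stateSpaceCore K G).toCore

theorem productBasis_orthonormal : Orthonormal ℂ (productBasis K G) := by
  classical
  rw [orthonormal_iff_ite]
  intro v w
  change ∑ u, (starRingEnd ℂ) ((productBasis K G).repr (productBasis K G v) u) *
      (productBasis K G).repr (productBasis K G w) u = _
  simp [Finsupp.single_apply]

end StateSpace

/-! ### The model -/

section Model

variable (C : ChainComplex AddCommGrpCat ℤ) (K : ℤ → Type*)
  (b : ∀ n, Module.Basis (K n) ℤ (C.X n)) (G : ChainComplex AddCommGrpCat ℤ)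

/-- A classical configuration is determined by its values on the generators. -/
noncomputable def configEquiv : PMap C G 0 ≃ (∀ x : (Σ n, K n), G.X x.1) where
  toFun f x := f.comp x.1 x.1 (add_zero _) (b x.1 x.2)
  invFun v := fun i =>
    ((b i.1.1).constr ℤ (fun y =>
      (G.XIsoOfEq (by have := i.2; omega : i.1.1 = i.1.2)).hom.hom (v ⟨i.1.1, y⟩))).toAddMonoidHom
  left_inv f := by
    funext i
    obtain ⟨⟨n, m⟩, h⟩ := i
    obtain rfl : n = m := by simpa using h.symm
    apply AddMonoidHom.toIntLinearMap_injective
    apply (b n).ext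
    intro y
    simp [PMap.comp, HomologicalComplex.XIsoOfEq]
  right_inv v := by
    funext x
    simp [PMap.comp, HomologicalComplex.XIsoOfEq]

/-- Evaluation `f ↦ f_n(x)` of `p`-maps at a generator `x ∈ K_n`, with values in `G_m`,
`m = n - p`. -/
noncomputable def evalAt (p : ℤ) (x : (Σ n, K n)) (m : ℤ) (h : m + p = x.1) :
    PMap C G p →+ G.X m where
  toFun f := f.comp x.1 m h (b x.1 x.2)
  map_zero' := by simp [PMap.comp]
  map_add' f g := by simp [PMap.comp]

open Classical in
/-- The local map `g x^*` in `hom(C, G)^p`, for `x ∈ K_n` and `g ∈ G_m`, `m = n - p`: it sends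
`x` to `g` and all other generators to `0`. -/
noncomputable def localMap (p : ℤ) (x : (Σ n, K n)) (m : ℤ) (h : m + p = x.1) (g : G.X m) :
    PMap C G p :=
  fun i => ((b i.1.1).constr ℤ (fun y =>
    if hx : x = ⟨i.1.1, y⟩ then
      (G.XIsoOfEq (by have := i.2; subst hx; simp only at h; omega : m = i.1.2)).hom.hom g
    else 0)).toAddMonoidHom

/-- The local map `r x_*` in the dual group of `hom(C, G)^p`, for `x ∈ K_n` and a character `r`
of `G_m`, `m = n - p`: it sends `f` to `r (f_n(x))`. -/
noncomputable def localChar (p : ℤ) (x : (Σ n, K n)) (m : ℤ) (h : m + p = x.1)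
    (r : AddChar (G.X m) Circle) : AddChar (PMap C G p) Circle :=
  r.compAddMonoidHom (evalAt C K b G p x m h)

variable [Fintype (Σ n, K n)]

/-- The basis `|f⟩ = ⨂_n ⨂_{x ∈ K_n} |f_n(x)⟩` of the state space, for `f ∈ hom(C, G)^0`. -/
noncomputable def ket : Module.Basis (PMap C G 0) ℂ (StateSpace K G) :=
  (productBasis K G).reindex (configEquiv C K b G).symm

/-- The shift operator `P_t |f⟩ = |f + t⟩`. -/
noncomputable def shiftOp (t : PMap C G 0) : StateSpace K G →ₗ[ℂ] StateSpace K G :=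
  (ket C K b G).constr ℂ (fun f => ket C K b G (f + t))

/-- The clock operator `Q_m |f⟩ = χ_m(f) |f⟩`. -/
noncomputable def clockOp (m : AddChar (PMap C G 0) Circle) :
    StateSpace K G →ₗ[ℂ] StateSpace K G :=
  (ket C K b G).constr ℂ (fun f => (m f : ℂ) • ket C K b G f)

/-- The gauge transformation `A_t = P_{δ^{-1} t}`, for `t ∈ hom(C, G)^{-1}`. -/
noncomputable def gaugeOp (t : PMap C G (-1)) : StateSpace K G →ₗ[ℂ] StateSpace K G :=
  shiftOp C K b G (PMap.delta C G (-1) 0 (by norm_num) t)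

/-- The holonomy operator `B_m = Q_{δ_1 m}`, for `m` in the dual group of `hom(C, G)^1`, where
`δ_1 m = m ∘ δ^0`. -/
noncomputable def holonomyOp (m : AddChar (PMap C G 1) Circle) :
    StateSpace K G →ₗ[ℂ] StateSpace K G :=
  clockOp C K b G (m.compAddMonoidHom (PMap.delta C G 0 1 (by norm_num)))

variable [∀ n, Fintype (G.X n)]

noncomputable instance circleCharFintype (S : Type*) [AddCommGroup S] [Finite S] :
    Fintype (AddChar S Circle) :=
  Fintype.ofEquiv (AddChar S ℂ) AddChar.circleEquivComplex.symm.toEquiv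

/-- The local gauge projector
`A_x^r = |G_{n+1}|⁻¹ ∑_{g ∈ G_{n+1}} χ_r(g) A_{g x^*}` for `x ∈ K_n`. -/
noncomputable def localGauge (x : (Σ n, K n)) (r : AddChar (G.X (x.1 + 1)) Circle) :
    StateSpace K G →ₗ[ℂ] StateSpace K G :=
  (Fintype.card (G.X (x.1 + 1)) : ℂ)⁻¹ • ∑ g : G.X (x.1 + 1),
    (r g : ℂ) • gaugeOp C K b G (localMap C K b G (-1) x (x.1 + 1) (by omega) g)

/-- The local holonomy projector
`B_x^g = |G_{n-1}|⁻¹ ∑_r χ_r(g) B_{r x_*}` for `x ∈ K_n`, where `r` runs over the characters of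
`G_{n-1}`. -/
noncomputable def localHolonomy (x : (Σ n, K n)) (g : G.X (x.1 - 1)) :
    StateSpace K G →ₗ[ℂ] StateSpace K G :=
  (Fintype.card (G.X (x.1 - 1)) : ℂ)⁻¹ • ∑ r : AddChar (G.X (x.1 - 1)) Circle,
    (r g : ℂ) • holonomyOp C K b G (localChar C K b G 1 x (x.1 - 1) (by omega) r)

/-- The Hamiltonian `H = - ∑_x A_x^0 - ∑_y B_y^0`. -/
noncomputable def hamiltonian : StateSpace K G →ₗ[ℂ] StateSpace K G :=
  - (∑ x : (Σ n, K n), localGauge C K b G x 0) - ∑ y : (Σ n, K n), localHolonomy C K b G y 0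

/-- The ground state subspace: the eigenspace of the Hamiltonian for its lowest eigenvalue. -/
noncomputable def groundStates : Submodule ℂ (StateSpace K G) :=
  Module.End.eigenspace (hamiltonian C K b G)
    ((sInf {E : ℝ | Module.End.HasEigenvalue (hamiltonian C K b G) (E : ℂ)} : ℝ) : ℂ)

end Model

/-! ### Splitting and lifting for free abelian groups -/

/-! Spectral part: $H=-\sum_i P_i$ with $N=2\sum_n|K_n|$ symmetric idempotents. For $H\psi=E\psi$,
`sum_norm_sub_apply_sq` gives $\sum_i\|\psi-P_i\psi\|^2=(E+N)\|\psi\|^2$, so $E\ge -N$, with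
equality exactly on common fixed vectors; commutation of the $P_i$ plays no role. In the basis
$|f\rangle$, being fixed by every $A_x^0$ means that the coefficients are invariant under
$\operatorname{im}\delta^{-1}$, and being fixed by every $B_x^0$ means that they are supported on
$\ker\delta^0$. Such coefficients are the functions on $H^0(C,G)$; this gives the dimension, and
since that dimension is positive, $-N$ is an eigenvalue.

Algebraic part: choose a free cover $\pi:Q_n\to H_n(G)$, lift it to cycles by $\alpha:Q_n\to
Z_n(G)$, and choose $\beta:\ker\pi\to G_{n+1}$ with $\partial\beta=\alpha$ on $\ker\pi$
(`nonempty_homologyCover`). Let $W$ be the group of families $u_n:C_n\to Q_n$ with $\pi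
u\partial=0$. It maps onto $\prod_n H^n(C,H_n(G))$ by $u\mapsto[\pi u_n]$, and to $H^0(C,G)$ by the
class of $\alpha u_n+\beta u_{n-1}\partial$. The second map is also onto and both have the same
kernel, so the two quotients of $W$ are isomorphic. The splitting of $C_n$ into cycles and a
complement is what makes this work. -/

theorem AddMonoidHom.exists_lift_of_projective {M A B : Type*} [AddCommGroup M] [AddCommGroup A]
    [AddCommGroup B] [Module.Projective ℤ M] (f : A →+ B) (hf : Function.Surjective f)
    (g : M →+ B) : ∃ h : M →+ A, ∀ x, f (h x) = g x := by
  obtain ⟨h, hh⟩ := Module.projective_lifting_property f.toIntLinearMap g.toIntLinearMap hf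
  exact ⟨h.toAddMonoidHom, fun x => LinearMap.congr_fun hh x⟩

theorem AddMonoidHom.exists_lift_of_range_le {M A B : Type*} [AddCommGroup M] [AddCommGroup A]
    [AddCommGroup B] [Module.Projective ℤ M] (f : A →+ B) (g : M →+ B)
    (hg : ∀ x, ∃ a, f a = g x) : ∃ h : M →+ A, ∀ x, f (h x) = g x := by
  obtain ⟨h, hh⟩ := AddMonoidHom.exists_lift_of_projective f.rangeRestrict
    f.rangeRestrict_surjective (g.codRestrict f.range hg)
  exact ⟨h, fun x => congrArg Subtype.val (hh x)⟩

/-- The kernel of a homomorphism to a finitely generated free abelian group is a direct summand. -/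
theorem AddMonoidHom.exists_projection_ker {M N : Type*} [AddCommGroup M] [AddCommGroup N]
    [Module.Finite ℤ N] [Module.Free ℤ N] (d : M →+ N) :
    ∃ p : M →+ M, (∀ x, d (p x) = 0) ∧ ∀ x, d x = 0 → p x = x := by
  -- The image is a subgroup of a free abelian group, so $d$ has a section $s$ over it; the
  -- projection is $1-sd$.
  have hproj : Module.Projective ℤ d.toIntLinearMap.range := inferInstance
  obtain ⟨s, hs⟩ := Module.projective_lifting_property d.toIntLinearMap.rangeRestrict
    LinearMap.id d.toIntLinearMap.surjective_rangeRestrict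
  have hs' : ∀ x, d (s (d.toIntLinearMap.rangeRestrict x)) = d x := fun x =>
    congrArg Subtype.val (LinearMap.congr_fun hs (d.toIntLinearMap.rangeRestrict x))
  refine ⟨AddMonoidHom.id M - (s.comp d.toIntLinearMap.rangeRestrict).toAddMonoidHom, ?_, ?_⟩
  · intro x
    exact (map_sub d _ _).trans (sub_eq_zero.2 (hs' x).symm)
  · intro x hx
    have : d.toIntLinearMap.rangeRestrict x = 0 := Subtype.ext hx
    change x - s (d.toIntLinearMap.rangeRestrict x) = x
    rw [this, map_zero, sub_zero]

/-- Two quotients of the same group with the same kernel are isomorphic. -/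
noncomputable def AddEquiv.ofSurjectiveOfKerEq {W A B : Type*} [AddCommGroup W] [AddCommGroup A]
    [AddCommGroup B] (f : W →+ A) (g : W →+ B) (hf : Function.Surjective f)
    (hg : Function.Surjective g) (h : ∀ w, f w = 0 ↔ g w = 0) : A ≃+ B :=
  (QuotientAddGroup.quotientKerEquivOfSurjective f hf).symm.trans
    ((QuotientAddGroup.quotientAddEquivOfEq (by ext w; exact h w)).trans
      (QuotientAddGroup.quotientKerEquivOfSurjective g hg))

theorem exists_surjective_of_equiv_quotient {X Y H : Type*} [AddCommGroup X] [AddCommGroup Y]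
    [AddCommGroup H] (f : X →+ Y) (e : H ≃+ Y ⧸ f.range) :
    ∃ c : Y →+ H, Function.Surjective c ∧ ∀ z, c z = 0 ↔ ∃ x, f x = z :=
  ⟨e.symm.toAddMonoidHom.comp (QuotientAddGroup.mk' f.range),
    e.symm.surjective.comp (QuotientAddGroup.mk'_surjective _), fun z =>
      (EmbeddingLike.map_eq_zero_iff (f := e.symm)).trans (QuotientAddGroup.eq_zero_iff z)⟩

/-! ### Cycles and homology of a complex of abelian groups -/

section Cycles

universe u

variable (G : ChainComplex AddCommGrpCat.{u} ℤ)

theorem ChainComplex.d_d_apply (i j k : ℤ) (x : G.X i) :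
    (G.d j k).hom ((G.d i j).hom x) = 0 := by
  rw [← AddCommGrpCat.comp_apply, G.d_comp_d]
  rfl

/-- The group of `n`-cycles of a complex. -/
abbrev cycleGroup (n : ℤ) : AddSubgroup (G.X n) := (G.d n (n - 1)).hom.ker

/-- `homology` refers to the neighbours of `n` through `prev` and `next`; keeping them as variables
`i`, `k` lets `subst` replace casts between degrees. -/
theorem exists_cycleClass_of_eq (n i k : ℤ) (hi : (ComplexShape.down ℤ).prev n = i)
    (hk : (ComplexShape.down ℤ).next n = k) :
    ∃ c : (G.d n k).hom.ker →+ G.homology n, Function.Surjective c ∧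
      ∀ z, c z = 0 ↔ ∃ y : G.X i, (G.d i n).hom y = z := by
  subst hi hk
  obtain ⟨c, hc, hc'⟩ := exists_surjective_of_equiv_quotient (G.sc n).abToCycles
    ((G.sc n).abHomologyIso).addCommGroupIsoToAddEquiv
  exact ⟨c, hc, fun z => (hc' z).trans
    ⟨fun ⟨y, hy⟩ => ⟨y, congrArg Subtype.val hy⟩, fun ⟨y, hy⟩ => ⟨y, Subtype.ext hy⟩⟩⟩

theorem exists_cycleClass (n : ℤ) : ∃ c : cycleGroup G n →+ G.homology n,
    Function.Surjective c ∧ ∀ z, c z = 0 ↔ ∃ y : G.X (n + 1), (G.d (n + 1) n).hom y = z :=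
  exists_cycleClass_of_eq G n (n + 1) (n - 1) (by simp) (by simp)

/-- The homology class of a cycle. -/
noncomputable def cycleClass (n : ℤ) : cycleGroup G n →+ G.homology n :=
  (exists_cycleClass G n).choose

theorem cycleClass_surjective (n : ℤ) : Function.Surjective (cycleClass G n) :=
  (exists_cycleClass G n).choose_spec.1

theorem cycleClass_eq_zero_iff {n m : ℤ} (h : n + 1 = m) (z : cycleGroup G n) :
    cycleClass G n z = 0 ↔ ∃ y : G.X m, (G.d m n).hom y = z := by
  subst h
  exact (exists_cycleClass G n).choose_spec.2 z

theorem d_eq_zero_of_mem_cycleGroup {n m : ℤ} (h : m + 1 = n) (z : cycleGroup G n) :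
    (G.d n m).hom z = 0 := by
  obtain rfl : m = n - 1 := by omega
  exact z.2

/-- A presentation of each homology group of `G` by a map of abelian groups `Q_n → H_n(G)`,
realised by chains of `G`: generators lift to cycles and relations lift to chains bounding them. -/
structure HomologyCover where
  /-- The generators. -/
  Q : ℤ → Type u
  [addCommGroup : ∀ n, AddCommGroup (Q n)]
  /-- The presentation map. -/
  toHomology : ∀ n, Q n →+ G.homology n
  toHomology_surjective : ∀ n, Function.Surjective (toHomology n)
  /-- The cycles representing the generators. -/
  toCycles : ∀ n, Q n →+ cycleGroup G n
  cycleClass_toCycles : ∀ n q, cycleClass G n (toCycles n q) = toHomology n q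
  /-- The chains bounding the relations. -/
  bounding : ∀ n m, n + 1 = m → ((toHomology n).ker →+ G.X m)
  d_bounding : ∀ n m (h : n + 1 = m) r, (G.d m n).hom (bounding n m h r) = toCycles n r

attribute [instance] HomologyCover.addCommGroup

theorem nonempty_homologyCover [∀ n, Finite (G.X n)] : Nonempty (HomologyCover G) := by
  have hfin : ∀ n, Finite (G.homology n) := fun n =>
    Finite.of_surjective _ (cycleClass_surjective G n)
  have hcov : ∀ n, ∃ π : (G.homology n →₀ ℤ) →+ G.homology n, Function.Surjective π := fun n =>
    ⟨(Finsupp.linearCombination ℤ (id : G.homology n → G.homology n)).toAddMonoidHom, fun x =>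
      ⟨Finsupp.single x 1, by simp⟩⟩
  choose π hπ using hcov
  choose α hα using fun n => AddMonoidHom.exists_lift_of_projective (cycleClass G n)
    (cycleClass_surjective G n) (π n)
  -- A subgroup of a free abelian group is projective, so bounding chains for the relations can be
  -- chosen additively.
  have hker : ∀ n, Module.Projective ℤ (π n).ker := fun n =>
    (inferInstance : Module.Projective ℤ (π n).toIntLinearMap.ker)
  have hbound : ∀ n m, n + 1 = m → ∃ β : (π n).ker →+ G.X m,
      ∀ r, (G.d m n).hom (β r) = α n r := fun n m h =>
    AddMonoidHom.exists_lift_of_range_le (G.d m n).hom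
      (((cycleGroup G n).subtype.comp (α n)).comp (π n).ker.subtype) (fun r =>
        (cycleClass_eq_zero_iff G h _).1 ((hα n r).trans r.2))
  choose β hβ using hbound
  exact ⟨{ Q := _, toHomology := π, toHomology_surjective := hπ, toCycles := α,
           cycleClass_toCycles := hα, bounding := β, d_bounding := hβ }⟩

end Cycles

/-! ### Families of homomorphisms of degree zero -/

section Family

variable {C G : ChainComplex AddCommGrpCat ℤ}

/-- The `0`-map with components `f_n : C_n → G_n`. -/
noncomputable def PMap.ofFamily : (∀ n, C.X n →+ G.X n) →+ PMap C G 0 where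
  toFun f := fun i => (G.XIsoOfEq (by have := i.2; omega : i.1.1 = i.1.2)).hom.hom.comp (f i.1.1)
  map_zero' := by
    funext i
    ext x
    simp
  map_add' f g := by
    funext i
    ext x
    simp

@[simp]
theorem PMap.ofFamily_comp (f : ∀ n, C.X n →+ G.X n) (n : ℤ) :
    (PMap.ofFamily f).comp n n (add_zero n) = f n := by
  ext x
  simp [PMap.ofFamily, PMap.comp, HomologicalComplex.XIsoOfEq]

theorem PMap.ext_comp_self {f g : PMap C G 0}
    (h : ∀ n x, f.comp n n (add_zero n) x = g.comp n n (add_zero n) x) : f = g := by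
  funext i
  obtain ⟨⟨n, m⟩, hi⟩ := i
  obtain rfl : n = m := by simpa using hi.symm
  ext x
  exact h n x

/-- The target degree is a variable `q` because it occurs both as `0 + 1` (in `HomCohomology`) and
as `1` (in `holonomyOp`). -/
theorem PMap.delta_zero_comp (f : PMap C G 0) {n m q : ℤ} (hq : 0 + 1 = q) (h : m + q = n)
    (x : C.X n) :
    (PMap.delta C G 0 q hq f).comp n m h x =
      f.comp m m (add_zero m) ((C.d n m).hom x) -
        (G.d n m).hom (f.comp n n (add_zero n) x) := by
  obtain rfl : q = 1 := by omega
  subst h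
  have h1 : ∀ k (hk : k = m) (h' : m + 0 = k), (f.comp k m h') ((C.d (m + 1) k).hom x) =
      f.comp m m (add_zero m) ((C.d (m + 1) m).hom x) := by
    rintro k rfl _
    rfl
  have := h1 (m + 1 - 1) (by omega) (by omega)
  simpa [PMap.delta, PMap.comp] using this

theorem PMap.delta_eq_zero_iff (f : PMap C G 0) {q : ℤ} (hq : 0 + 1 = q) :
    PMap.delta C G 0 q hq f = 0 ↔ ∀ n m : ℤ, m + 1 = n → ∀ x,
      f.comp m m (add_zero m) ((C.d n m).hom x) =
        (G.d n m).hom (f.comp n n (add_zero n) x) := by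
  obtain rfl : q = 1 := by omega
  constructor
  · intro h n m hnm x
    rw [← sub_eq_zero, ← PMap.delta_zero_comp f hq hnm x, h]
    rfl
  · intro h
    funext i
    ext x
    exact (PMap.delta_zero_comp f hq i.2 x).trans (sub_eq_zero.2 (h _ _ i.2 x))

/-- In degree $-1$ the sign $-(-1)^p$ is $+1$: this is the chain homotopy formula
$t\partial+\partial t$. -/
theorem PMap.delta_neg_one_comp {p : ℤ} (hp : p + 1 = 0) (t : PMap C G p) {k n m : ℤ}
    (hk : n + p = k) (hm : m + p = n) (x : C.X n) :
    (PMap.delta C G p 0 hp t).comp n n (add_zero n) x =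
      t.comp k n hk ((C.d n k).hom x) + (G.d m n).hom (t.comp n m hm x) := by
  obtain rfl : p = -1 := by omega
  obtain rfl : k = n - 1 := by omega
  obtain rfl : m = n + 1 := by omega
  simp [PMap.delta, PMap.comp]

end Family

/-! ### Comparison of `H^0(C, G)` with the cohomology of `C` with coefficients in `H_n(G)` -/

section Comparison

variable {C G : ChainComplex AddCommGrpCat ℤ}

theorem PMap.exists_delta_eq_iff {p : ℤ} (hp : p + 1 = 0) (f : PMap C G 0) :
    (∃ t, PMap.delta C G p 0 hp t = f) ↔
      ∃ t : ∀ n m : ℤ, n + 1 = m → (C.X n →+ G.X m), ∀ k n m (hk : k + 1 = n) (hm : n + 1 = m) x,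
        f.comp n n (add_zero n) x =
          t k n hk ((C.d n k).hom x) + (G.d m n).hom (t n m hm x) := by
  constructor
  · rintro ⟨t, rfl⟩
    exact ⟨fun n m h => t.comp n m (by omega), fun k n m hk hm x =>
      PMap.delta_neg_one_comp hp t (by omega) (by omega) x⟩
  · rintro ⟨t, ht⟩
    refine ⟨fun i => t i.1.1 i.1.2 (by have := i.2; omega), PMap.ext_comp_self fun n x => ?_⟩
    rw [ht (n - 1) n (n + 1) (by omega) rfl x]
    exact PMap.delta_neg_one_comp hp _ (by omega) (by omega) x

theorem HomCohomology.mk_eq_zero_iff (f : (PMap.delta C G 0 (0 + 1) rfl).ker) :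
    (QuotientAddGroup.mk f : HomCohomology C G 0) = 0 ↔
      ∃ t : ∀ n m : ℤ, n + 1 = m → (C.X n →+ G.X m), ∀ k n m (hk : k + 1 = n) (hm : n + 1 = m) x,
        f.1.comp n n (add_zero n) x =
          t k n hk ((C.d n k).hom x) + (G.d m n).hom (t n m hm x) := by
  rw [QuotientAddGroup.eq_zero_iff, AddSubgroup.mem_addSubgroupOf, AddMonoidHom.mem_range]
  exact PMap.exists_delta_eq_iff _ _

theorem CoeffCohomology.mk_eq_zero_iff {S : Type*} [AddCommGroup S] {n : ℤ}
    (f : (coeffD C S n (n + 1)).ker) :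
    (QuotientAddGroup.mk f : CoeffCohomology C S n) = 0 ↔
      ∃ s : C.X (n - 1) →+ S, ∀ x, s ((C.d n (n - 1)).hom x) = f.1 x := by
  rw [QuotientAddGroup.eq_zero_iff, AddSubgroup.mem_addSubgroupOf, AddMonoidHom.mem_range]
  exact exists_congr fun s => DFunLike.ext_iff

theorem ChainComplex.exists_projection_cycles [∀ n, Module.Finite ℤ (C.X n)]
    [∀ n, Module.Free ℤ (C.X n)] (n : ℤ) : ∃ p : C.X n →+ C.X n,
      (∀ m, m + 1 = n → ∀ x, (C.d n m).hom (p x) = 0) ∧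
        ∀ m, m + 1 = n → ∀ x, (C.d n m).hom x = 0 → p x = x := by
  obtain ⟨p, hp, hp'⟩ := (C.d n (n - 1)).hom.exists_projection_ker
  refine ⟨p, fun m h => ?_, fun m h => ?_⟩
  · obtain rfl : m = n - 1 := by omega
    exact hp
  · obtain rfl : m = n - 1 := by omega
    exact hp'

namespace HomologyCover

variable (R : HomologyCover G) (C)

/-- Families of maps `u_n : C_n → Q_n` which induce cocycles `C_n → H_n(G)`. -/
def cocycles : AddSubgroup (∀ n, C.X n →+ R.Q n) where
  carrier := {u | ∀ n m : ℤ, m + 1 = n → ∀ x, R.toHomology m (u m ((C.d n m).hom x)) = 0}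
  zero_mem' n m h x := by simp
  add_mem' {u v} hu hv n m h x := by simp [hu n m h x, hv n m h x]
  neg_mem' {u} hu n m h x := by simp [hu n m h x]

variable {C} {R}

theorem cocycles_apply (u : R.cocycles C) {n m : ℤ} (h : m + 1 = n) (x : C.X n) :
    R.toHomology m (u.1 m ((C.d n m).hom x)) = 0 :=
  u.2 n m h x

variable (C) (R)

/-- The cohomology classes `[π u_n] ∈ H^n(C, H_n(G))`. -/
noncomputable def toCoeffCohomology : R.cocycles C →+ ∀ n : ℤ, CoeffCohomology C (G.homology n) n :=
  AddMonoidHom.mk' (fun u n => QuotientAddGroup.mk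
    ⟨(R.toHomology n).comp (u.1 n), by
      ext x
      exact cocycles_apply u rfl x⟩) fun u v => by
    funext n
    refine congrArg QuotientAddGroup.mk (Subtype.ext ?_)
    ext x
    exact map_add (R.toHomology n) _ _

theorem toCoeffCohomology_surjective [∀ n, Module.Free ℤ (C.X n)] :
    Function.Surjective (R.toCoeffCohomology C) := by
  intro c
  choose f hf using fun n => QuotientAddGroup.mk_surjective (c n)
  choose u hu using fun n => AddMonoidHom.exists_lift_of_projective (R.toHomology n)
    (R.toHomology_surjective n) (f n).1
  refine ⟨⟨u, ?_⟩, funext fun n => ?_⟩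
  · rintro n m rfl x
    rw [hu]
    exact DFunLike.congr_fun (f m).2 x
  · rw [← hf n]
    refine congrArg QuotientAddGroup.mk (Subtype.ext ?_)
    ext x
    exact hu n x

theorem toCoeffCohomology_eq_zero_iff (u : R.cocycles C) :
    R.toCoeffCohomology C u = 0 ↔ ∃ s : ∀ n, C.X (n - 1) →+ G.homology n,
      ∀ n x, s n ((C.d n (n - 1)).hom x) = R.toHomology n (u.1 n x) := by
  rw [funext_iff, ← Classical.skolem (p := fun n (s : C.X (n - 1) →+ G.homology n) =>
    ∀ x, s ((C.d n (n - 1)).hom x) = R.toHomology n (u.1 n x))]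
  exact forall_congr' fun n => CoeffCohomology.mk_eq_zero_iff _

/-- The relation `u_m ∂ x` in `ker (Q_m → H_m(G))`. -/
noncomputable def relation (u : R.cocycles C) {n m : ℤ} (h : m + 1 = n) :
    C.X n →+ (R.toHomology m).ker :=
  ((u.1 m).comp (C.d n m).hom).codRestrict _ (cocycles_apply u h)

theorem relation_eq_zero (u : R.cocycles C) {n m : ℤ} (h : m + 1 = n) {x : C.X n}
    (hx : u.1 m ((C.d n m).hom x) = 0) : R.relation C u h x = 0 :=
  Subtype.ext hx

/-- The chain map with components `α u_n + β u_{n-1} ∂`. -/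
noncomputable def chainMap : R.cocycles C →+ PMap C G 0 :=
  PMap.ofFamily.comp (AddMonoidHom.mk' (fun u n =>
    ((cycleGroup G n).subtype.comp (R.toCycles n)).comp (u.1 n) +
      (R.bounding (n - 1) n (by omega)).comp (R.relation C u (by omega))) fun u v => by
    funext n
    ext x
    have : R.relation C (u + v) (by omega : n - 1 + 1 = n) x =
      R.relation C u (by omega) x + R.relation C v (by omega) x := rfl
    simp [this]
    abel)

theorem chainMap_comp (u : R.cocycles C) {n m : ℤ} (h : m + 1 = n) (x : C.X n) :
    (R.chainMap C u).comp n n (add_zero n) x =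
      R.toCycles n (u.1 n x) + R.bounding m n h (R.relation C u h x) := by
  obtain rfl : m = n - 1 := by omega
  simp [chainMap]

theorem chainMap_comp_of_eq_zero (u : R.cocycles C) {n m : ℤ} (h : m + 1 = n) {x : C.X n}
    (hx : u.1 m ((C.d n m).hom x) = 0) :
    (R.chainMap C u).comp n n (add_zero n) x = R.toCycles n (u.1 n x) := by
  rw [R.chainMap_comp C u h, R.relation_eq_zero C u h hx, map_zero, add_zero]

/-- On $\partial x$ the $\beta$-term vanishes since $\partial\partial=0$, leaving $\alpha u\partial
x$. Applying $\partial$ to the component at $x$ kills $\alpha u x$ and turns $\beta u\partial x$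
into the same $\alpha u\partial x$. -/
theorem delta_chainMap (u : R.cocycles C) {q : ℤ} (hq : 0 + 1 = q) :
    PMap.delta C G 0 q hq (R.chainMap C u) = 0 := by
  rw [PMap.delta_eq_zero_iff]
  intro n m h x
  rw [R.chainMap_comp C u h, R.chainMap_comp_of_eq_zero C u (sub_add_cancel m 1)
    (by rw [ChainComplex.d_d_apply, map_zero]), map_add, R.d_bounding,
    d_eq_zero_of_mem_cycleGroup G h, zero_add]
  rfl

/-- The class of the chain map `α u_n + β u_{n-1} ∂` in `H^0(C, G)`. -/
noncomputable def toHomCohomology : R.cocycles C →+ HomCohomology C G 0 :=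
  (QuotientAddGroup.mk' _).comp
    ((R.chainMap C).codRestrict _ fun u => R.delta_chainMap C u rfl)

theorem toHomCohomology_eq_zero_iff (u : R.cocycles C) :
    R.toHomCohomology C u = 0 ↔
      ∃ t : ∀ n m : ℤ, n + 1 = m → (C.X n →+ G.X m), ∀ k n m (hk : k + 1 = n) (hm : n + 1 = m) x,
        (R.chainMap C u).comp n n (add_zero n) x =
          t k n hk ((C.d n k).hom x) + (G.d m n).hom (t n m hm x) :=
  HomCohomology.mk_eq_zero_iff _

/-! ### The two maps out of the cocycles have the same kernel -/

/-- If $\pi u=s\partial$, lift $s$ to $\sigma$ with values in $Q$. Then $\rho=u-\sigma\partial$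
lands in $\ker\pi$ and satisfies $\rho\partial=u\partial$, so $\beta\rho+\alpha\sigma$ is a
null-homotopy of the chain map. -/
theorem toHomCohomology_eq_zero_of_toCoeffCohomology [∀ n, Module.Free ℤ (C.X n)]
    (u : R.cocycles C) (hu : R.toCoeffCohomology C u = 0) : R.toHomCohomology C u = 0 := by
  obtain ⟨s, hs⟩ := (R.toCoeffCohomology_eq_zero_iff C u).1 hu
  have hσ : ∀ n m : ℤ, n + 1 = m → ∃ σ : C.X n →+ R.Q m,
      ∀ x, R.toHomology m (σ ((C.d m n).hom x)) = R.toHomology m (u.1 m x) := by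
    intro n m h
    obtain rfl : n = m - 1 := by omega
    obtain ⟨σ, hσ⟩ := AddMonoidHom.exists_lift_of_projective (R.toHomology m)
      (R.toHomology_surjective m) (s m)
    exact ⟨σ, fun x => by rw [hσ, hs]⟩
  choose σ hσ using hσ
  let ρ : ∀ n, C.X n →+ (R.toHomology n).ker := fun n =>
    (u.1 n - (σ (n - 1) n (by omega)).comp (C.d n (n - 1)).hom).codRestrict _ fun x => by
      simp [AddMonoidHom.mem_ker, hσ]
  have hρ : ∀ k n (h : k + 1 = n) x,
      (ρ n x : R.Q n) = u.1 n x - σ k n h ((C.d n k).hom x) := by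
    intro k n h x
    obtain rfl : k = n - 1 := by omega
    rfl
  rw [toHomCohomology_eq_zero_iff]
  refine ⟨fun n m h => (R.bounding n m h).comp (ρ n) +
    ((cycleGroup G m).subtype.comp (R.toCycles m)).comp (σ n m h), ?_⟩
  intro k n m hk hm x
  have h1 : ρ k ((C.d n k).hom x) = R.relation C u hk x := by
    refine Subtype.ext ?_
    rw [hρ (k - 1) k (by omega), ChainComplex.d_d_apply, map_zero, sub_zero]
    rfl
  have h2 : (R.toCycles n (u.1 n x) : G.X n) =
      R.toCycles n (σ k n hk ((C.d n k).hom x)) + R.toCycles n (ρ n x) := by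
    rw [hρ k n hk, map_sub]
    simp
  rw [R.chainMap_comp C u hk, h2]
  simp only [AddMonoidHom.add_apply, AddMonoidHom.comp_apply, AddSubgroup.subtype_apply, map_add,
    h1, R.d_bounding, d_eq_zero_of_mem_cycleGroup G hm]
  abel

variable [∀ n, Module.Finite ℤ (C.X n)] [∀ n, Module.Free ℤ (C.X n)]

/-- Let $t$ be a null-homotopy and $p$ the projection onto cycles. On cycles the homotopy equation
reads $\alpha up=\partial tp$, so $\pi up=0$ and $tp-\beta up$ takes values in cycles. Its homology
class is the cochain $s$ with $s\partial=\pi u$. -/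
theorem toCoeffCohomology_eq_zero_of_toHomCohomology (u : R.cocycles C)
    (hu : R.toHomCohomology C u = 0) : R.toCoeffCohomology C u = 0 := by
  obtain ⟨t, ht⟩ := (R.toHomCohomology_eq_zero_iff C u).1 hu
  choose p hp hp' using ChainComplex.exists_projection_cycles (C := C)
  have hdp : ∀ n m x, (C.d n m).hom (p n x) = 0 := by
    intro n m x
    by_cases h : m + 1 = n
    · exact hp n m h x
    · rw [C.shape n m h]
      rfl
  have hpd : ∀ n m x, p m ((C.d n m).hom x) = (C.d n m).hom x := fun n m x =>
    hp' m (m - 1) (by omega) _ (ChainComplex.d_d_apply C _ _ _ x)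
  have hdu : ∀ n m (h : n + 1 = m) x,
      (R.toCycles n (u.1 n (p n x)) : G.X n) = (G.d m n).hom (t n m h (p n x)) := by
    intro n m h x
    rw [← R.chainMap_comp_of_eq_zero C u (sub_add_cancel n 1) (by rw [hdp, map_zero]),
      ht (n - 1) n m (by omega) h, hdp, map_zero, zero_add]
  have hup : ∀ n x, R.toHomology n (u.1 n (p n x)) = 0 := by
    intro n x
    rw [← R.cycleClass_toCycles, cycleClass_eq_zero_iff G rfl]
    exact ⟨_, (hdu n _ rfl x).symm⟩
  rw [toCoeffCohomology_eq_zero_iff]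
  let up : ∀ n, C.X n →+ (R.toHomology n).ker := fun n =>
    ((u.1 n).comp (p n)).codRestrict _ (hup n)
  have hcyc : ∀ k n (h : k + 1 = n) x,
      ((t k n h).comp (p k) - (R.bounding k n h).comp (up k)) x ∈ cycleGroup G n := by
    intro k n h x
    obtain rfl : k = n - 1 := by omega
    simp only [AddMonoidHom.mem_ker, AddMonoidHom.sub_apply, AddMonoidHom.comp_apply, map_sub,
      R.d_bounding]
    rw [← hdu]
    exact sub_self _
  refine ⟨fun n => (cycleClass G n).comp
    (((t (n - 1) n (by omega)).comp (p (n - 1)) -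
      (R.bounding (n - 1) n (by omega)).comp (up (n - 1))).codRestrict _
        (hcyc _ _ (by omega))), fun n x => ?_⟩
  rw [← sub_eq_zero, ← R.cycleClass_toCycles, AddMonoidHom.comp_apply, ← map_sub,
    cycleClass_eq_zero_iff G rfl]
  -- The homotopy equation at $x$ rearranges to $t\partial x-\beta u\partial x-\alpha ux=-\partial
  -- tx$.
  refine ⟨- t n (n + 1) rfl x, ?_⟩
  have h1 := ht (n - 1) n (n + 1) (by omega) rfl x
  have h2 : up (n - 1) ((C.d n (n - 1)).hom x) = R.relation C u (by omega) x :=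
    Subtype.ext (congrArg (u.1 (n - 1)) (hpd n (n - 1) x))
  rw [R.chainMap_comp C u (sub_add_cancel n 1)] at h1
  simp only [AddMonoidHom.codRestrict_apply, AddMonoidHom.sub_apply, AddMonoidHom.comp_apply,
    AddSubgroup.coe_sub, h2, hpd, map_neg]
  rw [← sub_eq_iff_eq_add'.2 h1]
  abel

/-! ### Surjectivity onto $H^0(C,G)$ -/

/-- Every class in `H^0(C, G)` is the sum of a class coming from a cocycle and the class of a
chain map which vanishes on cycles. -/
theorem exists_toHomCohomology_add_eq (a : HomCohomology C G 0) :
    ∃ (u : R.cocycles C) (g : (PMap.delta C G 0 (0 + 1) rfl).ker),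
      a = R.toHomCohomology C u + QuotientAddGroup.mk g ∧
      ∀ n m : ℤ, m + 1 = n → ∀ x, (C.d n m).hom x = 0 → g.1.comp n n (add_zero n) x = 0 := by
  obtain ⟨f, rfl⟩ := QuotientAddGroup.mk_surjective a
  choose p hp hp' using ChainComplex.exists_projection_cycles (C := C)
  have hf := (PMap.delta_eq_zero_iff f.1 rfl).1 f.2
  have hpd : ∀ n m x, p m ((C.d n m).hom x) = (C.d n m).hom x := fun n m x =>
    hp' m (m - 1) (by omega) _ (ChainComplex.d_d_apply C _ _ _ x)
  have hcyc : ∀ n x, (f.1.comp n n (add_zero n)).comp (p n) x ∈ cycleGroup G n := by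
    intro n x
    have := hf n (n - 1) (by omega) (p n x)
    rw [hp n (n - 1) (by omega), map_zero] at this
    exact this.symm
  -- `u` lifts $x\mapsto[f(px)]$. It is a cocycle because $f(\partial x)=\partial f(x)$ is a
  -- boundary.
  choose u hu using fun n => AddMonoidHom.exists_lift_of_projective (R.toHomology n)
    (R.toHomology_surjective n)
    ((cycleClass G n).comp (((f.1.comp n n (add_zero n)).comp (p n)).codRestrict _ (hcyc n)))
  have huW : u ∈ R.cocycles C := by
    intro n m h x
    rw [hu]
    refine (cycleClass_eq_zero_iff G h _).2 ⟨f.1.comp n n (add_zero n) x, ?_⟩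
    rw [← hf n m h]
    exact congrArg (f.1.comp m m (add_zero m)) (hpd n m x).symm
  have hpp : ∀ n x, p n (p n x) = p n x := fun n x =>
    hp' n (n - 1) (by omega) _ (hp n (n - 1) (by omega) x)
  have ht : ∀ n m, n + 1 = m → ∃ t : C.X n →+ G.X m, ∀ x, (G.d m n).hom (t x) =
      ((f.1.comp n n (add_zero n)).comp (p n) -
        (((cycleGroup G n).subtype.comp (R.toCycles n)).comp (u n)).comp (p n)) x := by
    intro n m h
    refine AddMonoidHom.exists_lift_of_range_le _ _ fun x => ?_
    have := (cycleClass_eq_zero_iff G h (((f.1.comp n n (add_zero n)).comp (p n)).codRestrict _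
      (hcyc n) x - R.toCycles n (u n (p n x)))).1 (by
        rw [map_sub, R.cycleClass_toCycles, hu, sub_eq_zero]
        refine congrArg (cycleClass G n) (Subtype.ext ?_)
        exact congrArg (f.1.comp n n (add_zero n)) (hpp n x).symm)
    exact this
  choose t ht using ht
  -- On cycles $f$ and $\alpha u$ differ by the boundary $\partial t$, so subtracting the homotopy
  -- `T` removes what is left of $f$ there.
  let T : PMap C G (0 - 1) := fun i => t i.1.1 i.1.2 (by have := i.2; omega)
  have hT : ∀ k n m (hk : k + 1 = n) (hm : n + 1 = m) x,
      (PMap.delta C G (0 - 1) 0 (by omega) T).comp n n (add_zero n) x =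
        t k n hk ((C.d n k).hom x) + (G.d m n).hom (t n m hm x) := fun k n m hk hm x =>
    PMap.delta_neg_one_comp (by omega) T (by omega) (by omega) x
  have hTker : PMap.delta C G (0 - 1) 0 (by omega) T ∈ (PMap.delta C G 0 (0 + 1) rfl).ker :=
    PMap.delta_delta _ _ _ _ _ _ _ _
  let U : (PMap.delta C G 0 (0 + 1) rfl).ker :=
    ⟨R.chainMap C ⟨u, huW⟩, R.delta_chainMap C ⟨u, huW⟩ rfl⟩
  refine ⟨⟨u, huW⟩, f - U - ⟨_, hTker⟩, ?_, ?_⟩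
  · have h0 : (QuotientAddGroup.mk (⟨_, hTker⟩ : (PMap.delta C G 0 (0 + 1) rfl).ker) :
        HomCohomology C G 0) = 0 :=
      (QuotientAddGroup.eq_zero_iff _).2 ⟨T, rfl⟩
    rw [QuotientAddGroup.mk_sub, QuotientAddGroup.mk_sub, h0, sub_zero]
    exact (add_sub_cancel _ _).symm
  · intro n m h x hx
    have h1 : (f.1 - R.chainMap C ⟨u, huW⟩ -
        PMap.delta C G (0 - 1) 0 (by omega) T).comp n n (add_zero n) x =
        f.1.comp n n (add_zero n) x - (R.chainMap C ⟨u, huW⟩).comp n n (add_zero n) x -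
        (PMap.delta C G (0 - 1) 0 (by omega) T).comp n n (add_zero n) x := rfl
    refine h1.trans ?_
    rw [R.chainMap_comp_of_eq_zero C _ h (by rw [hx, map_zero]), hT m n (n + 1) h rfl, hx, ht]
    simp [hp' n m h x hx]

/-- As $g$ kills boundaries, it takes values in cycles, so $x\mapsto[g(x)]$ lifts to $Q$. The lift
can be made to vanish on cycles; its chain map is then just $\alpha u$, which is homologous to $g$
pointwise. -/
theorem exists_toHomCohomology_eq (g : (PMap.delta C G 0 (0 + 1) rfl).ker)
    (hg : ∀ n m : ℤ, m + 1 = n → ∀ x, (C.d n m).hom x = 0 → g.1.comp n n (add_zero n) x = 0) :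
    ∃ u : R.cocycles C, R.toHomCohomology C u = QuotientAddGroup.mk g := by
  choose p hp hp' using ChainComplex.exists_projection_cycles (C := C)
  have hgc := (PMap.delta_eq_zero_iff g.1 rfl).1 g.2
  have hpd : ∀ n m x, p m ((C.d n m).hom x) = (C.d n m).hom x := fun n m x =>
    hp' m (m - 1) (by omega) _ (ChainComplex.d_d_apply C _ _ _ x)
  have hgp : ∀ n x, g.1.comp n n (add_zero n) (p n x) = 0 := fun n x =>
    hg n (n - 1) (by omega) _ (hp n (n - 1) (by omega) x)
  have hpp : ∀ n x, p n (p n x) = p n x := fun n x =>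
    hp' n (n - 1) (by omega) _ (hp n (n - 1) (by omega) x)
  have hcyc : ∀ n x, g.1.comp n n (add_zero n) x ∈ cycleGroup G n := by
    intro n x
    refine (hgc n (n - 1) (by omega) x).symm.trans ?_
    exact hg _ (n - 1 - 1) (by omega) _ (ChainComplex.d_d_apply C _ _ _ x)
  choose w hw using fun n => AddMonoidHom.exists_lift_of_projective (R.toHomology n)
    (R.toHomology_surjective n)
    ((cycleClass G n).comp ((g.1.comp n n (add_zero n)).codRestrict _ (hcyc n)))
  let u : ∀ n, C.X n →+ R.Q n := fun n => w n - (w n).comp (p n)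
  have hud : ∀ n m x, u m ((C.d n m).hom x) = 0 := by
    intro n m x
    simp [u, hpd]
  have hup : ∀ n x, u n (p n x) = 0 := by
    intro n x
    simp [u, hpp]
  have hu : ∀ n x, R.toHomology n (u n x) = cycleClass G n ⟨_, hcyc n x⟩ := by
    intro n x
    have h0 : R.toHomology n (w n (p n x)) = 0 := by
      rw [hw]
      refine (congrArg (cycleClass G n) (Subtype.ext ?_)).trans (map_zero (cycleClass G n))
      exact hgp n x
    simp only [u, AddMonoidHom.sub_apply, AddMonoidHom.comp_apply, map_sub, h0, sub_zero]
    exact hw n x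
  have huW : u ∈ R.cocycles C := fun n m h x => by rw [hud, map_zero]
  have ht : ∀ n m, n + 1 = m → ∃ t : C.X n →+ G.X m, ∀ x, (G.d m n).hom (t x) =
      (((cycleGroup G n).subtype.comp (R.toCycles n)).comp (u n) -
        g.1.comp n n (add_zero n)) x := by
    intro n m h
    refine AddMonoidHom.exists_lift_of_range_le _ _ fun x => ?_
    have := (cycleClass_eq_zero_iff G h (R.toCycles n (u n x) - ⟨_, hcyc n x⟩)).1 (by
      rw [map_sub, R.cycleClass_toCycles, hu, sub_self])
    exact this
  choose t ht using ht
  refine ⟨⟨u, huW⟩, ?_⟩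
  have hsub : (QuotientAddGroup.mk (⟨R.chainMap C ⟨u, huW⟩, R.delta_chainMap C ⟨u, huW⟩ rfl⟩ - g) :
      HomCohomology C G 0) = 0 := by
    rw [HomCohomology.mk_eq_zero_iff]
    -- Subtracting $tp$ makes the homotopy vanish on cycles, so its $t\partial$ term disappears;
    -- $\partial t$ is unchanged because $\alpha u-g$ is zero on cycles.
    refine ⟨fun n m h => t n m h - (t n m h).comp (p n), fun k n m hk hm x => ?_⟩
    have h1 : (R.chainMap C ⟨u, huW⟩ - g.1).comp n n (add_zero n) x =
      (R.chainMap C ⟨u, huW⟩).comp n n (add_zero n) x - g.1.comp n n (add_zero n) x := rfl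
    refine h1.trans ?_
    rw [R.chainMap_comp_of_eq_zero C _ hk (hud _ _ _)]
    simp [hpd, ht, hup, hgp]
  rw [QuotientAddGroup.mk_sub, sub_eq_zero] at hsub
  exact hsub

theorem toHomCohomology_surjective : Function.Surjective (R.toHomCohomology C) := by
  intro a
  obtain ⟨u, g, rfl, hg⟩ := R.exists_toHomCohomology_add_eq C a
  obtain ⟨v, hv⟩ := R.exists_toHomCohomology_eq C g hg
  exact ⟨u + v, by rw [map_add, hv]⟩

/-- The isomorphism `H^0(C, G) ≃ ∏_n H^n(C, H_n(G))` determined by a cover of the homology. -/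
noncomputable def homCohomologyEquiv :
    HomCohomology C G 0 ≃+ ∀ n : ℤ, CoeffCohomology C (G.homology n) n :=
  AddEquiv.ofSurjectiveOfKerEq (R.toHomCohomology C) (R.toCoeffCohomology C)
    (R.toHomCohomology_surjective C) (R.toCoeffCohomology_surjective C) fun u =>
      ⟨R.toCoeffCohomology_eq_zero_of_toHomCohomology C u,
        R.toHomCohomology_eq_zero_of_toCoeffCohomology C u⟩

end HomologyCover

end Comparison

/-! ### Cardinalities -/

/-- The cardinality of a product of groups, all but finitely many of which are trivial. -/
theorem Nat.card_pi_eq_finprod {ι : Type*} {X : ι → Type*} {s : Set ι} (hs : s.Finite)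
    (hX : ∀ i ∉ s, Nat.card (X i) = 1) :
    (Function.mulSupport fun i => Nat.card (X i)).Finite ∧
      Nat.card (∀ i, X i) = ∏ᶠ i, Nat.card (X i) := by
  classical
  have hsub : (Function.mulSupport fun i => Nat.card (X i)) ⊆ s := fun i hi => by
    by_contra h
    exact hi (hX i h)
  refine ⟨hs.subset hsub, ?_⟩
  have hsf : (Function.mulSupport fun i => Nat.card (X i)) ⊆ hs.toFinset := by simpa using hsub
  have h1 : Nat.card (∀ i : {i // i ∉ hs.toFinset}, X i) = 1 := by
    have hX' : ∀ i : {i // i ∉ hs.toFinset}, Subsingleton (X i) ∧ Nonempty (X i) := fun i =>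
      Nat.card_eq_one_iff_unique.1 (hX i.1 (by simpa using i.2))
    have := fun i => (hX' i).1
    have := fun i => (hX' i).2
    exact Nat.card_eq_one_iff_unique.2 ⟨inferInstance, inferInstance⟩
  rw [Nat.card_congr (Equiv.piEquivPiSubtypeProd (· ∈ hs.toFinset) X), Nat.card_prod, h1, mul_one,
    Nat.card_pi, finprod_eq_prod_of_mulSupport_subset _ hsf]
  exact Finset.prod_coe_sort hs.toFinset fun i => Nat.card (X i)

theorem CoeffCohomology.card_eq_one (C : ChainComplex AddCommGrpCat ℤ) (S : Type*)
    [AddCommGroup S] (n : ℤ) [Subsingleton (C.X n)] : Nat.card (CoeffCohomology C S n) = 1 := by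
  have : Subsingleton (C.X n →+ S) := ⟨fun f g => by
    ext x
    rw [Subsingleton.elim x 0, map_zero, map_zero]⟩
  have : Subsingleton (CoeffCohomology C S n) := Quotient.instSubsingletonQuotient _
  exact Nat.card_unique

/-! ### Sums of symmetric projectors -/

section Projectors

variable {V : Type*} [NormedAddCommGroup V] [InnerProductSpace ℂ V]

theorem LinearMap.IsSymmetric.norm_sub_apply_sq {P : V →ₗ[ℂ] V} (hs : P.IsSymmetric)
    (hi : ∀ ψ, P (P ψ) = P ψ) (ψ : V) :
    ‖ψ - P ψ‖ ^ 2 = ‖ψ‖ ^ 2 - RCLike.re (inner ℂ ψ (P ψ)) := by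
  have h1 : inner ℂ (P ψ) (P ψ) = inner ℂ ψ (P ψ) := by rw [hs ψ (P ψ), hi]
  rw [@norm_sub_sq ℂ, ← inner_self_eq_norm_sq (𝕜 := ℂ) (P ψ), h1]
  ring

variable {ι : Type*} [Fintype ι] {P : ι → V →ₗ[ℂ] V}

theorem LinearMap.IsSymmetric.neg_sum (hs : ∀ i, (P i).IsSymmetric) :
    (-∑ i, P i).IsSymmetric := by
  intro φ ψ
  simp only [LinearMap.neg_apply, LinearMap.sum_apply, inner_neg_left, inner_neg_right,
    sum_inner, inner_sum, hs _ φ ψ]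

/-- The eigenvalue equation paired with $\psi$ gives
$\sum_i\langle\psi,P_i\psi\rangle=-E\|\psi\|^2$. The left side is a sum of squares, which yields
both the lower bound on $E$ and the equality case. -/
theorem LinearMap.IsSymmetric.sum_norm_sub_apply_sq (hs : ∀ i, (P i).IsSymmetric)
    (hi : ∀ i ψ, P i (P i ψ) = P i ψ) {E : ℝ} {ψ : V} (hE : (-∑ i, P i) ψ = (E : ℂ) • ψ) :
    ∑ i, ‖ψ - P i ψ‖ ^ 2 = (E + Fintype.card ι) * ‖ψ‖ ^ 2 := by
  have h1 : ∑ i, RCLike.re (inner ℂ ψ (P i ψ)) = - (E * ‖ψ‖ ^ 2) := by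
    rw [← map_sum, ← inner_sum, ← LinearMap.sum_apply,
      show (∑ i, P i) ψ = -((E : ℂ) • ψ) by rw [← hE, LinearMap.neg_apply, neg_neg],
      inner_neg_right, inner_smul_right, map_neg, inner_self_eq_norm_sq_to_K]
    norm_cast
    rw [RCLike.re_to_complex, Complex.re_ofReal_mul]
    exact congrArg (fun r => -(E * r)) (Complex.ofReal_re _)
  simp only [fun i => (hs i).norm_sub_apply_sq (hi i) ψ, Finset.sum_sub_distrib, h1]
  simp
  ring

theorem LinearMap.IsSymmetric.neg_card_le_of_hasEigenvalue (hs : ∀ i, (P i).IsSymmetric)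
    (hi : ∀ i ψ, P i (P i ψ) = P i ψ) {E : ℝ}
    (hE : Module.End.HasEigenvalue (-∑ i, P i) (E : ℂ)) : -(Fintype.card ι : ℝ) ≤ E := by
  obtain ⟨ψ, hψ⟩ := hE.exists_hasEigenvector
  have h1 := sum_norm_sub_apply_sq hs hi hψ.apply_eq_smul
  have h2 : 0 < ‖ψ‖ ^ 2 := by have := norm_pos_iff.2 hψ.2; positivity
  have h3 : 0 ≤ (E + Fintype.card ι) * ‖ψ‖ ^ 2 :=
    h1 ▸ Finset.sum_nonneg fun i _ => sq_nonneg _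
  linarith [nonneg_of_mul_nonneg_left h3 h2]

theorem LinearMap.IsSymmetric.mem_eigenspace_neg_card_iff (hs : ∀ i, (P i).IsSymmetric)
    (hi : ∀ i ψ, P i (P i ψ) = P i ψ) (ψ : V) :
    ψ ∈ Module.End.eigenspace (-∑ i, P i) ((-(Fintype.card ι : ℝ) : ℝ) : ℂ) ↔
      ∀ i, P i ψ = ψ := by
  rw [Module.End.mem_eigenspace_iff]
  constructor
  · intro h i
    have h1 := sum_norm_sub_apply_sq hs hi h
    rw [neg_add_cancel, zero_mul, Finset.sum_eq_zero_iff_of_nonneg fun i _ => sq_nonneg _] at h1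
    have := h1 i (Finset.mem_univ i)
    rw [sq_eq_zero_iff, norm_eq_zero, sub_eq_zero] at this
    exact this.symm
  · intro h
    simp [h, ← Nat.cast_smul_eq_nsmul ℂ]

end Projectors

/-! ### Translations and multiplications on a space with a basis indexed by a finite group -/

section GroupBasis

variable {F V : Type*} [NormedAddCommGroup V] [InnerProductSpace ℂ V] {e : Module.Basis F ℂ V}

theorem Module.Basis.repr_apply_of_diagonal {P : V →ₗ[ℂ] V} {a : F → ℂ}
    (hP : ∀ f, P (e f) = a f • e f) (ψ : V) (f : F) : e.repr (P ψ) f = a f * e.repr ψ f := by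
  classical
  let l : V →ₗ[ℂ] ℂ := e.coord f
  have : l ∘ₗ P = a f • l := by
    refine e.ext fun g => ?_
    by_cases h : g = f
    · subst h
      simp [l, hP]
    · simp [l, hP, h]
  exact LinearMap.congr_fun this ψ

theorem Module.Basis.inner_eq_sum_repr [Fintype F] (he : Orthonormal ℂ e) (φ ψ : V) :
    inner ℂ φ ψ = ∑ f, (starRingEnd ℂ) (e.repr φ f) * e.repr ψ f := by
  rw [← e.sum_repr φ, ← e.sum_repr ψ, he.inner_sum]
  simp

theorem LinearMap.isSymmetric_of_diagonal [Finite F] (he : Orthonormal ℂ e) {P : V →ₗ[ℂ] V}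
    {a : F → ℂ} (hP : ∀ f, P (e f) = a f • e f) (ha : ∀ f, (starRingEnd ℂ) (a f) = a f) :
    P.IsSymmetric := by
  have := Fintype.ofFinite F
  intro φ ψ
  simp only [Module.Basis.inner_eq_sum_repr he, Module.Basis.repr_apply_of_diagonal hP, map_mul,
    ha]
  exact Finset.sum_congr rfl fun f _ => by ring

variable [AddCommGroup F]

theorem Module.Basis.repr_apply_of_translation {S : V →ₗ[ℂ] V} {t : F}
    (hS : ∀ f, S (e f) = e (f + t)) (ψ : V) (f : F) : e.repr (S ψ) f = e.repr ψ (f - t) := by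
  classical
  have : e.coord f ∘ₗ S = e.coord (f - t) := by
    refine e.ext fun g => ?_
    simp [hS, Finsupp.single_apply, eq_sub_iff_add_eq]
  exact LinearMap.congr_fun this ψ

theorem inner_translation_left [Finite F] (he : Orthonormal ℂ e) {S S' : V →ₗ[ℂ] V} {t : F}
    (hS : ∀ f, S (e f) = e (f + t)) (hS' : ∀ f, S' (e f) = e (f + -t)) (φ ψ : V) :
    inner ℂ (S φ) ψ = inner ℂ φ (S' ψ) := by
  have := Fintype.ofFinite F
  simp only [Module.Basis.inner_eq_sum_repr he, Module.Basis.repr_apply_of_translation hS,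
    Module.Basis.repr_apply_of_translation hS']
  exact Fintype.sum_equiv (Equiv.subRight t) _ _ fun f => by simp

variable {A : Type*} [AddCommGroup A] [Fintype A] {τ : A →+ F} {S : A → V →ₗ[ℂ] V}

/-- The average of translations is symmetric. -/
theorem LinearMap.isSymmetric_average [Finite F] (he : Orthonormal ℂ e)
    (hS : ∀ a f, S a (e f) = e (f + τ a)) :
    ((Fintype.card A : ℂ)⁻¹ • ∑ a, S a).IsSymmetric := by
  intro φ ψ
  simp only [LinearMap.smul_apply, LinearMap.sum_apply, inner_smul_left, inner_smul_right,
    sum_inner, inner_sum, map_inv₀, Complex.conj_natCast]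
  congr 1
  -- The adjoint of translation by $\tau(a)$ is translation by $\tau(-a)$.
  refine Fintype.sum_equiv (Equiv.neg A) _ _ fun a => ?_
  exact inner_translation_left he (hS a) (fun f => by simp [hS]) φ ψ

theorem translation_average (hS : ∀ a f, S a (e f) = e (f + τ a)) (c : A) (ψ : V) :
    S c (((Fintype.card A : ℂ)⁻¹ • ∑ a, S a) ψ) = ((Fintype.card A : ℂ)⁻¹ • ∑ a, S a) ψ := by
  have h1 : ∀ a, S c (S a ψ) = S (a + c) ψ := by
    intro a
    have : S c ∘ₗ S a = S (a + c) := e.ext fun f => by simp [hS, add_assoc]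
    exact LinearMap.congr_fun this ψ
  simp only [LinearMap.smul_apply, LinearMap.sum_apply, map_smul, map_sum, h1]
  congr 1
  exact Fintype.sum_equiv (Equiv.addRight c) _ _ fun a => rfl

theorem average_eq_self_of_forall {ψ : V} (h : ∀ a, S a ψ = ψ) :
    ((Fintype.card A : ℂ)⁻¹ • ∑ a, S a) ψ = ψ := by
  have : (Fintype.card A : ℂ) ≠ 0 := Nat.cast_ne_zero.2 Fintype.card_ne_zero
  simp only [LinearMap.smul_apply, LinearMap.sum_apply, h, Finset.sum_const, Finset.card_univ,
    ← Nat.cast_smul_eq_nsmul ℂ]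
  rw [smul_smul, inv_mul_cancel₀ this, one_smul]

theorem average_average (hS : ∀ a f, S a (e f) = e (f + τ a)) (ψ : V) :
    ((Fintype.card A : ℂ)⁻¹ • ∑ a, S a) (((Fintype.card A : ℂ)⁻¹ • ∑ a, S a) ψ) =
      ((Fintype.card A : ℂ)⁻¹ • ∑ a, S a) ψ :=
  average_eq_self_of_forall fun c => translation_average hS c ψ

theorem average_eq_self_iff (hS : ∀ a f, S a (e f) = e (f + τ a)) (ψ : V) :
    ((Fintype.card A : ℂ)⁻¹ • ∑ a, S a) ψ = ψ ↔ ∀ a, S a ψ = ψ :=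
  ⟨fun h a => by rw [← h]; exact translation_average hS a ψ, average_eq_self_of_forall⟩

/-- The vectors supported on a subgroup `Z` and invariant under a subgroup `B` of `Z` form a space
of dimension `|Z / B|`. -/
theorem finrank_eq_card_quotient [Finite F] (e : Module.Basis F ℂ V) {Z B : AddSubgroup F}
    (hBZ : B ≤ Z) {W : Submodule ℂ V}
    (hW : ∀ ψ, ψ ∈ W ↔ (∀ t ∈ B, ∀ f, e.repr ψ (f - t) = e.repr ψ f) ∧
      ∀ f ∉ Z, e.repr ψ f = 0) :
    Module.finrank ℂ W = Nat.card (Z ⧸ B.addSubgroupOf Z) := by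
  classical
  have := Fintype.ofFinite F
  have := Fintype.ofFinite (Z ⧸ B.addSubgroupOf Z)
  let ext : ((Z ⧸ B.addSubgroupOf Z) → ℂ) →ₗ[ℂ] (F → ℂ) :=
    { toFun := fun c f => if h : f ∈ Z then c (QuotientAddGroup.mk ⟨f, h⟩) else 0
      map_add' := fun c d => by
        funext f
        by_cases h : f ∈ Z <;> simp [h]
      map_smul' := fun c d => by
        funext f
        by_cases h : f ∈ Z <;> simp [h] }
  have hext : ∀ c (z : Z), ext c z = c (QuotientAddGroup.mk z) := fun c z => dif_pos z.2
  have hext' : ∀ c f, f ∉ Z → ext c f = 0 := fun c f h => dif_neg h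
  let Φ : ((Z ⧸ B.addSubgroupOf Z) → ℂ) →ₗ[ℂ] V := e.equivFun.symm.toLinearMap ∘ₗ ext
  have hΦ : ∀ c f, e.repr (Φ c) f = ext c f := fun c f =>
    congrFun (e.equivFun.apply_symm_apply (ext c)) f
  have hinj : Function.Injective Φ := by
    refine e.equivFun.symm.injective.comp fun c d h => funext fun q => ?_
    obtain ⟨z, rfl⟩ := QuotientAddGroup.mk_surjective q
    exact (hext c z).symm.trans ((congrFun h z).trans (hext d z))
  have hrange : LinearMap.range Φ = W := by
    ext ψ
    rw [hW, LinearMap.mem_range]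
    constructor
    · rintro ⟨c, rfl⟩
      refine ⟨fun t ht f => ?_, fun f hf => by rw [hΦ, hext' c f hf]⟩
      rw [hΦ, hΦ]
      by_cases hf : f ∈ Z
      · have hft : f - t ∈ Z := Z.sub_mem hf (hBZ ht)
        rw [hext c ⟨f, hf⟩, hext c ⟨f - t, hft⟩]
        refine congrArg c (QuotientAddGroup.eq.2 ?_)
        rw [AddSubgroup.mem_addSubgroupOf]
        simpa using ht
      · have hft : f - t ∉ Z := fun h => hf (by simpa using Z.add_mem h (hBZ ht))
        rw [hext' c f hf, hext' c _ hft]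
    · rintro ⟨hinv, hsupp⟩
      refine ⟨fun q => Quotient.liftOn' q (fun z => e.repr ψ z) fun z w hzw => ?_, ?_⟩
      · have hzw' := QuotientAddGroup.leftRel_apply.1 hzw
        rw [AddSubgroup.mem_addSubgroupOf] at hzw'
        have := hinv _ hzw' w
        simpa using this
      · refine e.ext_elem fun f => ?_
        rw [hΦ]
        by_cases hf : f ∈ Z
        · exact hext _ ⟨f, hf⟩
        · rw [hext' _ f hf, hsupp f hf]
  rw [← hrange, LinearMap.finrank_range_of_inj hinj, Module.finrank_fintype_fun_eq_card,
    Nat.card_eq_fintype_card]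

end GroupBasis

theorem sum_circleChar_apply {S : Type*} [AddCommGroup S] [Fintype S] [DecidableEq S] (a : S) :
    ∑ r : AddChar S Circle, (r a : ℂ) = if a = 0 then (Fintype.card S : ℂ) else 0 := by
  rw [← AddChar.sum_apply_eq_ite a]
  exact Fintype.sum_equiv AddChar.circleEquivComplex.toEquiv _ _ fun r => rfl

/-! ### The local projectors -/

section LocalProjectors

variable (C : ChainComplex AddCommGrpCat ℤ) (K : ℤ → Type*)
  (b : ∀ n, Module.Basis (K n) ℤ (C.X n)) (G : ChainComplex AddCommGrpCat ℤ)

theorem PMap.ext_evalAt {p : ℤ} {f g : PMap C G p}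
    (h : ∀ x m (hm : m + p = x.1), evalAt C K b G p x m hm f = evalAt C K b G p x m hm g) :
    f = g := by
  funext i
  apply AddMonoidHom.toIntLinearMap_injective
  exact (b i.1.1).ext fun y => h ⟨i.1.1, y⟩ i.1.2 i.2

theorem evalAt_localMap_self {p : ℤ} (x : Σ n, K n) (m : ℤ) (h : m + p = x.1) (g : G.X m) :
    evalAt C K b G p x m h (localMap C K b G p x m h g) = g := by
  simp [evalAt, localMap, PMap.comp, HomologicalComplex.XIsoOfEq]

theorem evalAt_localMap_of_ne {p : ℤ} {x z : Σ n, K n} (hxz : x ≠ z) (m : ℤ) (h : m + p = x.1)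
    (g : G.X m) (k : ℤ) (hk : k + p = z.1) :
    evalAt C K b G p z k hk (localMap C K b G p x m h g) = 0 := by
  simp [evalAt, localMap, PMap.comp, hxz]

/-- The local maps `g x^*`, additively in `g`. -/
noncomputable def localMapHom (p : ℤ) (x : Σ n, K n) (m : ℤ) (h : m + p = x.1) :
    G.X m →+ PMap C G p :=
  AddMonoidHom.mk' (localMap C K b G p x m h) fun g g' => by
    refine PMap.ext_evalAt C K b G fun z k hk => ?_
    rw [map_add]
    by_cases hxz : x = z
    · subst hxz
      obtain rfl : k = m := by omega
      simp only [evalAt_localMap_self]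
    · simp only [evalAt_localMap_of_ne C K b G hxz, add_zero]

theorem delta_eq_zero_iff_evalAt (f : PMap C G 0) :
    PMap.delta C G 0 1 (by norm_num) f = 0 ↔ ∀ x : Σ n, K n,
      evalAt C K b G 1 x (x.1 - 1) (by omega) (PMap.delta C G 0 1 (by norm_num) f) = 0 := by
  constructor
  · intro h x
    rw [h, map_zero]
  · intro h
    refine PMap.ext_evalAt C K b G fun x m hm => ?_
    obtain rfl : m = x.1 - 1 := by omega
    rw [h, map_zero]

variable [Fintype (Σ n, K n)]

/-- The local maps $gx^*$ generate $\hom(C,G)^{-1}$, so invariance under the local gauge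
transformations is invariance under all of $\operatorname{im}\delta^{-1}$. -/
theorem sum_localMap (t : PMap C G (-1)) :
    ∑ x : Σ n, K n, localMap C K b G (-1) x (x.1 + 1) (by omega)
      (evalAt C K b G (-1) x (x.1 + 1) (by omega) t) = t := by
  refine PMap.ext_evalAt C K b G fun z k hk => ?_
  obtain rfl : k = z.1 + 1 := by omega
  rw [map_sum, Finset.sum_eq_single z]
  · exact evalAt_localMap_self C K b G z _ _ _
  · exact fun x _ hxz => evalAt_localMap_of_ne C K b G hxz _ _ _ _ _
  · exact fun h => (h (Finset.mem_univ z)).elim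

theorem ket_orthonormal [∀ n, Fintype (G.X n)] : Orthonormal ℂ (ket C K b G) := by
  rw [ket, Module.Basis.coe_reindex]
  exact (productBasis_orthonormal K G).comp _ (Equiv.injective _)

theorem shiftOp_ket (t f : PMap C G 0) :
    shiftOp C K b G t (ket C K b G f) = ket C K b G (f + t) :=
  Module.Basis.constr_basis _ _ _ _

theorem clockOp_ket (m : AddChar (PMap C G 0) Circle) (f : PMap C G 0) :
    clockOp C K b G m (ket C K b G f) = (m f : ℂ) • ket C K b G f :=
  Module.Basis.constr_basis _ _ _ _

/-- The gauge transformation by `g x^*` as a translation, additively in `g`. -/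
noncomputable def localTranslation (x : Σ n, K n) : G.X (x.1 + 1) →+ PMap C G 0 :=
  (PMap.delta C G (-1) 0 (by norm_num)).comp
    (localMapHom C K b G (-1) x (x.1 + 1) (by omega))

theorem gaugeOp_localMap_ket (x : Σ n, K n) (g : G.X (x.1 + 1)) (f : PMap C G 0) :
    gaugeOp C K b G (localMap C K b G (-1) x (x.1 + 1) (by omega) g) (ket C K b G f) =
      ket C K b G (f + localTranslation C K b G x g) :=
  shiftOp_ket C K b G _ f

variable [∀ n, Fintype (G.X n)]

theorem PMap.finite_zero (b : ∀ n, Module.Basis (K n) ℤ (C.X n)) : Finite (PMap C G 0) :=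
  Finite.of_equiv _ (configEquiv C K b G).symm

theorem localGauge_zero (x : Σ n, K n) :
    localGauge C K b G x 0 = (Fintype.card (G.X (x.1 + 1)) : ℂ)⁻¹ • ∑ g : G.X (x.1 + 1),
      gaugeOp C K b G (localMap C K b G (-1) x (x.1 + 1) (by omega) g) := by
  simp [localGauge]

-- By orthogonality of characters, averaging $r(v)$ over all $r$ gives the indicator of $v=0$, here
-- with $v=(\delta^0f)_x$.
open Classical in
theorem localHolonomy_zero_ket (x : Σ n, K n) (f : PMap C G 0) :
    localHolonomy C K b G x 0 (ket C K b G f) =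
      (if evalAt C K b G 1 x (x.1 - 1) (by omega) (PMap.delta C G 0 1 (by norm_num) f) = 0
        then (1 : ℂ) else 0) • ket C K b G f := by
  have h1 : ∀ r : AddChar (G.X (x.1 - 1)) Circle,
      holonomyOp C K b G (localChar C K b G 1 x (x.1 - 1) (by omega) r) (ket C K b G f) =
        (r (evalAt C K b G 1 x (x.1 - 1) (by omega) (PMap.delta C G 0 1 (by norm_num) f)) : ℂ) •
          ket C K b G f := fun r => clockOp_ket C K b G _ f
  have h2 : (Fintype.card (G.X (x.1 - 1)) : ℂ) ≠ 0 := Nat.cast_ne_zero.2 Fintype.card_ne_zero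
  simp only [localHolonomy, LinearMap.smul_apply, LinearMap.sum_apply, h1, AddChar.map_zero_eq_one,
    Circle.coe_one, one_smul, ← Finset.sum_smul, sum_circleChar_apply, smul_smul]
  split_ifs
  · rw [inv_mul_cancel₀ h2]
  · rw [mul_zero]

theorem localGauge_zero_isSymmetric (x : Σ n, K n) : (localGauge C K b G x 0).IsSymmetric := by
  have := PMap.finite_zero C K G b
  rw [localGauge_zero]
  exact LinearMap.isSymmetric_average (ket_orthonormal C K b G) (gaugeOp_localMap_ket C K b G x)

theorem localGauge_zero_idem (x : Σ n, K n) (ψ : StateSpace K G) :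
    localGauge C K b G x 0 (localGauge C K b G x 0 ψ) = localGauge C K b G x 0 ψ := by
  have := PMap.finite_zero C K G b
  rw [localGauge_zero]
  exact average_average (gaugeOp_localMap_ket C K b G x) ψ

theorem localHolonomy_zero_isSymmetric (x : Σ n, K n) :
    (localHolonomy C K b G x 0).IsSymmetric := by
  classical
  have := PMap.finite_zero C K G b
  exact LinearMap.isSymmetric_of_diagonal (ket_orthonormal C K b G)
    (localHolonomy_zero_ket C K b G x) fun f => by split_ifs <;> simp

theorem localHolonomy_zero_idem (x : Σ n, K n) (ψ : StateSpace K G) :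
    localHolonomy C K b G x 0 (localHolonomy C K b G x 0 ψ) = localHolonomy C K b G x 0 ψ := by
  classical
  have := PMap.finite_zero C K G b
  have h := Module.Basis.repr_apply_of_diagonal (localHolonomy_zero_ket C K b G x)
  refine (ket C K b G).ext_elem fun f => ?_
  rw [h, h]
  split_ifs <;> simp

theorem forall_localGauge_zero_eq_iff (ψ : StateSpace K G) :
    (∀ x : Σ n, K n, localGauge C K b G x 0 ψ = ψ) ↔
      ∀ t ∈ (PMap.delta C G (-1) 0 (by norm_num)).range, ∀ f,
        (ket C K b G).repr ψ (f - t) = (ket C K b G).repr ψ f := by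
  have := PMap.finite_zero C K G b
  have h1 : ∀ x : Σ n, K n, localGauge C K b G x 0 ψ = ψ ↔
      ∀ g f, (ket C K b G).repr ψ (f - localTranslation C K b G x g) =
        (ket C K b G).repr ψ f := by
    intro x
    rw [localGauge_zero, average_eq_self_iff (gaugeOp_localMap_ket C K b G x)]
    refine forall_congr' fun g => ?_
    rw [(ket C K b G).ext_elem_iff]
    exact forall_congr' fun f => by
      rw [Module.Basis.repr_apply_of_translation (gaugeOp_localMap_ket C K b G x g)]
  simp only [h1]
  constructor
  · rintro h _ ⟨t, rfl⟩
    -- The translations that preserve the coefficients of $\psi$ are closed under sums, so it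
    -- suffices to treat the local summands of $t$.
    rw [← sum_localMap C K b G t, map_sum]
    refine Finset.sum_induction _ (fun s => ∀ f, (ket C K b G).repr ψ (f - s) =
      (ket C K b G).repr ψ f) (fun s s' hs hs' f => ?_) (fun f => by rw [sub_zero])
      fun x _ => h x _
    rw [← sub_sub, hs', hs]
  · exact fun h x g => h _ ⟨_, rfl⟩

theorem forall_localHolonomy_zero_eq_iff (ψ : StateSpace K G) :
    (∀ x : Σ n, K n, localHolonomy C K b G x 0 ψ = ψ) ↔
      ∀ f, PMap.delta C G 0 1 (by norm_num) f ≠ 0 → (ket C K b G).repr ψ f = 0 := by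
  classical
  have := PMap.finite_zero C K G b
  have h1 : ∀ x : Σ n, K n, localHolonomy C K b G x 0 ψ = ψ ↔
      ∀ f, evalAt C K b G 1 x (x.1 - 1) (by omega) (PMap.delta C G 0 1 (by norm_num) f) ≠ 0 →
        (ket C K b G).repr ψ f = 0 := by
    intro x
    rw [(ket C K b G).ext_elem_iff]
    refine forall_congr' fun f => ?_
    rw [Module.Basis.repr_apply_of_diagonal (localHolonomy_zero_ket C K b G x)]
    split_ifs with h
    · simp [h]
    · simp [h, eq_comm]
  simp only [h1]
  rw [forall_comm]
  refine forall_congr' fun f => ?_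
  rw [Ne, delta_eq_zero_iff_evalAt C K b G, not_forall, forall_exists_index]

/-! ### The ground states -/

/-- All local projectors, indexed by two copies of the set of generators. -/
noncomputable def localProjector : (Σ n, K n) ⊕ (Σ n, K n) →
    (StateSpace K G →ₗ[ℂ] StateSpace K G) :=
  Sum.elim (fun x => localGauge C K b G x 0) fun x => localHolonomy C K b G x 0

theorem hamiltonian_eq_neg_sum : hamiltonian C K b G = -∑ i, localProjector C K b G i := by
  rw [Fintype.sum_sum_type, neg_add, ← sub_eq_add_neg]
  rfl

theorem localProjector_isSymmetric (i : (Σ n, K n) ⊕ (Σ n, K n)) :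
    (localProjector C K b G i).IsSymmetric :=
  match i with
  | .inl x => localGauge_zero_isSymmetric C K b G x
  | .inr x => localHolonomy_zero_isSymmetric C K b G x

theorem localProjector_idem (i : (Σ n, K n) ⊕ (Σ n, K n)) (ψ : StateSpace K G) :
    localProjector C K b G i (localProjector C K b G i ψ) = localProjector C K b G i ψ :=
  match i with
  | .inl x => localGauge_zero_idem C K b G x ψ
  | .inr x => localHolonomy_zero_idem C K b G x ψ

theorem neg_card_sum_self : (-(Fintype.card ((Σ n, K n) ⊕ (Σ n, K n)) : ℝ)) =
    -2 * (Fintype.card (Σ n, K n) : ℝ) := by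
  rw [Fintype.card_sum]
  push_cast
  ring

theorem mem_eigenspace_hamiltonian_iff (ψ : StateSpace K G) :
    ψ ∈ Module.End.eigenspace (hamiltonian C K b G)
        ((-2 * (Fintype.card (Σ n, K n) : ℝ) : ℝ) : ℂ) ↔
      ∀ x : Σ n, K n, localGauge C K b G x 0 ψ = ψ ∧ localHolonomy C K b G x 0 ψ = ψ := by
  rw [hamiltonian_eq_neg_sum, ← neg_card_sum_self,
    LinearMap.IsSymmetric.mem_eigenspace_neg_card_iff (localProjector_isSymmetric C K b G)
      (localProjector_idem C K b G), Sum.forall, forall_and]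
  rfl

theorem finite_homCohomology (b : ∀ n, Module.Basis (K n) ℤ (C.X n)) :
    Finite (HomCohomology C G 0) := by
  have := PMap.finite_zero C K G b
  infer_instance

theorem finrank_eigenspace_hamiltonian :
    Module.finrank ℂ (Module.End.eigenspace (hamiltonian C K b G)
        ((-2 * (Fintype.card (Σ n, K n) : ℝ) : ℝ) : ℂ)) = Nat.card (HomCohomology C G 0) := by
  have := PMap.finite_zero C K G b
  refine finrank_eq_card_quotient (ket C K b G) ?_ fun ψ => ?_
  · rintro _ ⟨t, rfl⟩
    exact PMap.delta_delta _ _ _ _ _ _ _ t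
  · rw [mem_eigenspace_hamiltonian_iff, forall_and, forall_localGauge_zero_eq_iff,
      forall_localHolonomy_zero_eq_iff]
    rfl

theorem isLeast_eigenvalue_hamiltonian :
    IsLeast {E : ℝ | Module.End.HasEigenvalue (hamiltonian C K b G) (E : ℂ)}
      (-2 * (Fintype.card (Σ n, K n) : ℝ)) := by
  constructor
  -- A zero eigenspace would force $|H^0(C,G)|=0$, whereas a finite group has positive order.
  · intro hbot
    have hdim := finrank_eigenspace_hamiltonian C K b G
    have := finite_homCohomology C K G b
    rw [show Module.End.eigenspace _ _ = ⊥ from hbot, finrank_bot] at hdim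
    exact Nat.card_pos.ne hdim
  · intro E hE
    rw [← neg_card_sum_self]
    rw [Set.mem_ofPred_eq, hamiltonian_eq_neg_sum] at hE
    exact LinearMap.IsSymmetric.neg_card_le_of_hasEigenvalue (localProjector_isSymmetric C K b G)
      (localProjector_idem C K b G) hE

theorem groundStates_eq : groundStates C K b G =
    Module.End.eigenspace (hamiltonian C K b G)
      ((-2 * (Fintype.card (Σ n, K n) : ℝ) : ℝ) : ℂ) := by
  rw [groundStates, (isLeast_eigenvalue_hamiltonian C K b G).csInf_eq]

end LocalProjectors

theorem theorem1 (C : ChainComplex AddCommGrpCat ℤ) (K : ℤ → Type*) [Fintype (Σ n, K n)]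
    (b : ∀ n, Module.Basis (K n) ℤ (C.X n))
    (G : ChainComplex AddCommGrpCat ℤ) [∀ n, Fintype (G.X n)] :
    -- the Hamiltonian is self-adjoint and has a lowest eigenvalue
    (hamiltonian C K b G).IsSymmetric ∧
    IsLeast {E : ℝ | Module.End.HasEigenvalue (hamiltonian C K b G) (E : ℂ)}
      (-2 * (Fintype.card (Σ n, K n) : ℝ)) ∧
    -- its ground states are the states fixed by all local projectors
    (∀ ψ : StateSpace K G, ψ ∈ groundStates C K b G ↔
      ∀ x : (Σ n, K n), localGauge C K b G x 0 ψ = ψ ∧ localHolonomy C K b G x 0 ψ = ψ) ∧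
    -- the ground state degeneracy
    Finite (HomCohomology C G 0) ∧
    Module.finrank ℂ (groundStates C K b G) = Nat.card (HomCohomology C G 0) ∧
    Nonempty (HomCohomology C G 0 ≃+ ∀ n : ℤ, CoeffCohomology C (G.homology n) n) ∧
    (Function.mulSupport fun n : ℤ => Nat.card (CoeffCohomology C (G.homology n) n)).Finite ∧
    Nat.card (HomCohomology C G 0) =
      ∏ᶠ n : ℤ, Nat.card (CoeffCohomology C (G.homology n) n) := by
  have hK : ∀ n, Finite (K n) := fun n =>
    Finite.of_injective (fun x => (⟨n, x⟩ : Σ n, K n)) sigma_mk_injective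
  have hC : ∀ n, Module.Free ℤ (C.X n) := fun n => .of_basis (b n)
  have hC' : ∀ n, Module.Finite ℤ (C.X n) := fun n => .of_basis (b n)
  obtain ⟨R⟩ := nonempty_homologyCover G
  -- Outside the finite set of degrees that contain a generator, $C_n=0$ and the cohomology is
  -- trivial.
  have hcard := Nat.card_pi_eq_finprod (X := fun n : ℤ => CoeffCohomology C (G.homology n) n)
    (Set.finite_range (Sigma.fst : (Σ n, K n) → ℤ)) fun n hn => by
      have : IsEmpty (K n) := ⟨fun x => hn ⟨⟨n, x⟩, rfl⟩⟩
      have : Subsingleton (C.X n) := (b n).repr.toEquiv.subsingleton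
      exact CoeffCohomology.card_eq_one C _ n
  refine ⟨?_, isLeast_eigenvalue_hamiltonian C K b G, fun ψ => ?_, finite_homCohomology C K G b,
    ?_, ⟨R.homCohomologyEquiv C⟩, hcard.1, ?_⟩
  · rw [hamiltonian_eq_neg_sum]
    exact LinearMap.IsSymmetric.neg_sum (localProjector_isSymmetric C K b G)
  · rw [groundStates_eq, mem_eigenspace_hamiltonian_iff]
  · rw [groundStates_eq, finrank_eigenspace_hamiltonian]
  · rw [← hcard.2]
    exact Nat.card_congr (R.homCohomologyEquiv C).toEquiv
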